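/- The board is the infinite square grid, whose cells are identified with $\mathbb{Z}^2$ (each cell is named by its lower left lattice point). Let $P_5$ be the straight polyomino of five cells; its copies are the sets of five consecutive cells in a row or in a column. A pairing for $P_5$ is a bijection $\rho : X \to Y$ between disjoint sets $X, Y \subseteq \mathbb{Z}^2$ such that every copy $A$ of $P_5$ contains a pair, i.e. there is $x \in X$ with $\{x, \rho(x)\} \subseteq A$; it is identified with its set of pairs $\{\{x,\rho(x)\} : x \in X\}$. (Neither $X \cup Y = \mathbb{Z}^2$ nor that paired cells are close to each other is assumed.) Call $\{(x,y),(x+1,y)\}$ the lying domino at $(x,y)$ and $\{(x,y),(x,y+1)\}$ the standing domino at $(x,y)$. Define two sets of pairs: - $T_1$ (a chessboard with $2\times 2$ fields packed alternately by two lying and two standing dominoes): for all $i,j \in \mathbb{Z}$, the lying dominoes at $(2i,2j)$ and $(2i,2j+1)$ if $i+j$ is even, and the standing dominoes at $(2i,2j)$ and $(2i+1,2j)$ if $i+j$ is odd. - $T_2$ (the "zipper"): the lying dominoes at all $(x,y)$ with $x-y \equiv 0 \pmod 4$, and the standing dominoes at all $(x,y)$ with $x-y\equiv 3 \pmod 4$.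 **Lemma 9.** For every pairing $\rho : X \to Y$ for $P_5$, the set of pairs $\{\{x,\rho(x)\} : x \in X\}$ is the image of $T_1$ or of $T_2$ under a rotation of the grid by a multiple of $90^\circ$ followed by a translation by a vector of $\mathbb{Z}^2$. -/

import Mathlib

/-- Winning pairing strategy for Breaker on the hypergraph with vertex type `V` and edge set `E`:
a bijection `ρ` from `X` onto `Y`, where `X` and `Y` are disjoint sets of vertices, such that every
edge contains some pair `{x, ρ x}` with `x ∈ X`. Values of `ρ` outside `X` play no role. -/
structure IsWinningPairing {V : Type*} (E : Set (Set V)) (X Y : Set V) (ρ : V → V) : Prop where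
  disjoint : Disjoint X Y
  bijOn : Set.BijOn ρ X Y
  blocks : ∀ A ∈ E, ∃ x ∈ X, ({x, ρ x} : Set V) ⊆ A

/-- The set of unordered pairs `{x, ρ x}`, `x ∈ X`. -/
def pairsOf {V : Type*} (X : Set V) (ρ : V → V) : Set (Sym2 V) :=
  (fun x => s(x, ρ x)) '' X

/-- Cells of the infinite square grid; a cell is named by its lower left lattice point. -/
abbrev Cell : Type := ℤ × ℤ

/-- The copies of the straight polyomino `P_ℓ` in the grid: all sets of `ℓ` consecutive cells
of a row or of a column. -/
def straightPolyominoes (ℓ : ℕ) : Set (Set Cell) :=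
  {A | ∃ a b : ℤ, A = {c | ∃ i : ℕ, i < ℓ ∧ c = (a + i, b)} ∨
                  A = {c | ∃ i : ℕ, i < ℓ ∧ c = (a, b + i)}}

/-- The lying domino with left cell `(x, y)`. -/
def lying (x y : ℤ) : Sym2 Cell := s((x, y), (x + 1, y))

/-- The standing domino with lower cell `(x, y)`. -/
def standing (x y : ℤ) : Sym2 Cell := s((x, y), (x, y + 1))

/-- `T₁`: the grid is cut into the `2 × 2` fields with lower left cells `(2 * i, 2 * j)`; a field
is packed with two lying dominoes if `i + j` is even, with two standing dominoes if it is odd. -/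
def patternT1 : Set (Sym2 Cell) :=
  {p | ∃ i j : ℤ, Even (i + j) ∧ (p = lying (2 * i) (2 * j) ∨ p = lying (2 * i) (2 * j + 1))} ∪
  {p | ∃ i j : ℤ, Odd (i + j) ∧ (p = standing (2 * i) (2 * j) ∨ p = standing (2 * i + 1) (2 * j))}

/-- `T₂`: diagonal staircases of lying dominoes, each shifted by one against the next, alternate
with diagonal staircases of standing dominoes. The cells with `x - y ≡ 0, 1 (mod 4)` are covered by
the lying dominoes and those with `x - y ≡ 2, 3 (mod 4)` by the standing ones. -/
def patternT2 : Set (Sym2 Cell) :=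
  {p | ∃ x y : ℤ, x - y ≡ 0 [ZMOD 4] ∧ p = lying x y} ∪
  {p | ∃ x y : ℤ, x - y ≡ 3 [ZMOD 4] ∧ p = standing x y}

/-- Rotation of the grid by a quarter turn. -/
def quarterTurn (c : Cell) : Cell := (-c.2, c.1)

/-- `S` is a translated and rotated copy of `T`: the image of `T` under `k` quarter turns
followed by the translation by `t`. -/
def IsCopy (S T : Set (Sym2 Cell)) : Prop :=
  ∃ (k : ℕ) (t : Cell), S = Sym2.map (fun c => quarterTurn^[k] c + t) '' T

/-- A symmetric partial matching on the integers such that every five consecutive integers contain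
a matched pair. -/
structure IsLineMatching (p : ℤ → ℤ → Prop) : Prop where
  symm : ∀ {a b}, p a b → p b a
  unique : ∀ {a b c}, p a b → p a c → b = c
  window : ∀ a, ∃ x y, a ≤ x ∧ x < y ∧ y ≤ a + 4 ∧ p x y

/-! ### Counting matched cells on a line -/

open Classical in
/-- The integer-valued indicator of a proposition. -/
noncomputable def indicator (q : Prop) : ℤ := if q then 1 else 0

theorem indicator_of_true {q : Prop} (h : q) : indicator q = 1 := if_pos h

theorem indicator_of_false {q : Prop} (h : ¬ q) : indicator q = 0 := if_neg h

theorem indicator_nonneg (q : Prop) : 0 ≤ indicator q := by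
  by_cases h : q <;> simp [indicator, h]

theorem indicator_congr_iff {q r : Prop} : indicator q = indicator r ↔ (q ↔ r) := by
  by_cases h : q <;> by_cases h' : r <;> simp [indicator, h, h']

/-- The number of integers satisfying `m` among `a, a + 1, a + 2, a + 3`. -/
noncomputable def windowCount (m : ℤ → Prop) (a : ℤ) : ℤ :=
  indicator (m a) + indicator (m (a + 1)) + indicator (m (a + 2)) + indicator (m (a + 3))

namespace IsLineMatching

variable {p : ℤ → ℤ → Prop}

/-- The four cells lie in two windows of five. If neither window's pair lies inside the four, one
pair uses `a - 1` and the other `a + 4`; their other ends are distinct by uniqueness of partners. -/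
theorem exists_two_matched (hp : IsLineMatching p) (a : ℤ) :
    ∃ x y, a ≤ x ∧ x < y ∧ y ≤ a + 3 ∧ (∃ z, p x z) ∧ ∃ z, p y z := by
  obtain ⟨x, y, hax, hxy, hya, h⟩ := hp.window a
  obtain ⟨x', y', hax', hxy', hya', h'⟩ := hp.window (a - 1)
  by_cases hy : y ≤ a + 3
  · exact ⟨x, y, hax, hxy, hy, ⟨_, h⟩, ⟨_, hp.symm h⟩⟩
  by_cases hx : a ≤ x'
  · exact ⟨x', y', hx, hxy', by omega, ⟨_, h'⟩, ⟨_, hp.symm h'⟩⟩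
  rcases lt_trichotomy x y' with hlt | rfl | hlt
  · exact ⟨x, y', hax, hlt, by omega, ⟨_, h⟩, ⟨_, hp.symm h'⟩⟩
  · have := hp.unique h (hp.symm h')
    omega
  · exact ⟨y', x, by omega, hlt, by omega, ⟨_, hp.symm h'⟩, ⟨_, h⟩⟩

theorem two_le_windowCount (hp : IsLineMatching p) (a : ℤ) :
    2 ≤ windowCount (fun x => ∃ z, p x z) a := by
  obtain ⟨x, y, hax, hxy, hya, hx, hy⟩ := hp.exists_two_matched a
  have hx' := indicator_of_true hx
  have hy' := indicator_of_true hy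
  have h0 := indicator_nonneg (∃ z, p a z)
  have h1 := indicator_nonneg (∃ z, p (a + 1) z)
  have h2 := indicator_nonneg (∃ z, p (a + 2) z)
  have h3 := indicator_nonneg (∃ z, p (a + 3) z)
  simp only [windowCount]
  have cx : x = a ∨ x = a + 1 ∨ x = a + 2 := by omega
  have cy : y = a + 1 ∨ y = a + 2 ∨ y = a + 3 := by omega
  rcases cx with rfl | rfl | rfl <;> rcases cy with rfl | rfl | rfl <;> omega

end IsLineMatching

/-- Consecutive windows of four differ only by trading `a` for `a + 4`. -/
theorem periodic_of_windowCount {m : ℤ → Prop} (hm : ∀ a, windowCount m a = 2) (a k : ℤ) :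
    m (a + 4 * k) ↔ m a := by
  have step : Function.Periodic (fun a => indicator (m a)) 4 := by
    intro a
    have h0 := hm a
    have h1 := hm (a + 1)
    simp only [windowCount, add_assoc] at h0 h1
    norm_num at h0 h1
    show indicator (m (a + 4)) = indicator (m a)
    omega
  have := step.int_mul k a
  rw [← indicator_congr_iff, mul_comm]
  exact this

/-- If `m` holds exactly twice in every window of four, it holds at `a` but not at `a - 1`, then it
fails at `a + 3` and holds at exactly one of `a + 1` and `a + 2`. -/
theorem windowCount_cases {m : ℤ → Prop} (hm : ∀ a, windowCount m a = 2) {a : ℤ} (ha : m a)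
    (ha' : ¬ m (a - 1)) : ¬ m (a + 3) ∧ (m (a + 1) ∧ ¬ m (a + 2) ∨ ¬ m (a + 1) ∧ m (a + 2)) := by
  have h3 : ¬ m (a + 3) := by
    rw [← periodic_of_windowCount hm (a - 1) 1] at ha'
    convert ha' using 2
    ring
  have h := hm a
  rw [windowCount, indicator_of_true ha, indicator_of_false h3] at h
  refine ⟨h3, ?_⟩
  by_cases h1 : m (a + 1) <;> by_cases h2 : m (a + 2) <;> simp_all [indicator]

namespace IsLineMatching

variable {p : ℤ → ℤ → Prop}

/-- In the pattern 1100 some window of five has only `a` and `a + 1` available. The pattern 1010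
fails: two windows would force `a + 2` to be paired both with `a` and with `a + 4`. -/
theorem domino (hp : IsLineMatching p) (hm : ∀ a, windowCount (fun x => ∃ z, p x z) a = 2) {a : ℤ}
    (ha : ∃ z, p a z) (ha' : ¬ ∃ z, p (a - 1) z) :
    p a (a + 1) ∧ ¬ ∃ z, p (a + 2) z := by
  have per := periodic_of_windowCount hm
  obtain ⟨h3, ⟨h1, h2⟩ | ⟨h1, h2⟩⟩ := windowCount_cases hm ha ha'
  · refine ⟨?_, h2⟩
    have hm2 : ¬ ∃ z, p (a - 2) z := by
      have := per (a - 2) 1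
      rw [show a - 2 + 4 * 1 = a + 2 by ring] at this
      exact fun h => h2 (this.2 h)
    obtain ⟨x, y, hx, hxy, hy, h⟩ := hp.window (a - 2)
    have mx : ∃ z, p x z := ⟨_, h⟩
    have my : ∃ z, p y z := ⟨_, hp.symm h⟩
    have n1 : x ≠ a - 2 := by rintro rfl; exact hm2 mx
    have n2 : x ≠ a - 1 := by rintro rfl; exact ha' mx
    have n3 : y ≠ a - 1 := by rintro rfl; exact ha' my
    have n4 : y ≠ a + 2 := by rintro rfl; exact h2 my
    obtain rfl : x = a := by omega
    obtain rfl : y = x + 1 := by omega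
    exact h
  · exfalso
    have h5 : ¬ ∃ z, p (a + 5) z := by
      have := per (a + 1) 1
      rw [show a + 1 + 4 * 1 = a + 5 by ring] at this
      exact fun h => h1 (this.1 h)
    obtain ⟨x, y, hx, hxy, hy, h⟩ := hp.window (a - 1)
    have mx : ∃ z, p x z := ⟨_, h⟩
    have my : ∃ z, p y z := ⟨_, hp.symm h⟩
    have n1 : x ≠ a - 1 := by rintro rfl; exact ha' mx
    have n2 : x ≠ a + 1 := by rintro rfl; exact h1 mx
    have n3 : y ≠ a + 1 := by rintro rfl; exact h1 my
    have n4 : y ≠ a + 3 := by rintro rfl; exact h3 my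
    obtain rfl : x = a := by omega
    obtain rfl : y = x + 2 := by omega
    obtain ⟨u, v, hu, huv, hv, h'⟩ := hp.window (x + 1)
    have mu : ∃ z, p u z := ⟨_, h'⟩
    have mv : ∃ z, p v z := ⟨_, hp.symm h'⟩
    have k1 : u ≠ x + 1 := by rintro rfl; exact h1 mu
    have k2 : u ≠ x + 3 := by rintro rfl; exact h3 mu
    have k3 : v ≠ x + 3 := by rintro rfl; exact h3 mv
    have k4 : v ≠ x + 5 := by rintro rfl; exact h5 mv
    obtain rfl : u = x + 2 := by omega
    have := hp.unique (hp.symm h) h'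
    omega

theorem exists_shift (hp : IsLineMatching p)
    (hm : ∀ a, windowCount (fun x => ∃ z, p x z) a = 2) :
    ∃ s : ℤ, ∀ x, (∃ z, p x z) ↔ (x - s) % 4 < 2 := by
  have per := periodic_of_windowCount hm
  -- If no run had a start, periodicity would make all or none of four consecutive integers matched,
  -- a count of 4 or 0.
  obtain ⟨s, hs, hs'⟩ : ∃ s, (∃ z, p s z) ∧ ¬ ∃ z, p (s - 1) z := by
    by_contra! hcon
    have h := hm 0
    have h0 := per (-1) 1
    have a1 := hcon 1
    have a2 := hcon 2
    have a3 := hcon 3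
    have a0 := hcon 0
    norm_num at a0 a1 a2 a3 h0
    have e : (∃ z, p 0 z) ∧ (∃ z, p 1 z) ∧ (∃ z, p 2 z) ∧ (∃ z, p 3 z) ∨
        (¬ ∃ z, p 0 z) ∧ (¬ ∃ z, p 1 z) ∧ (¬ ∃ z, p 2 z) ∧ (¬ ∃ z, p 3 z) := by
      have b0 : (∃ z, p 0 z) → ∃ z, p (-1) z := fun ⟨z, hz⟩ => a0 z hz
      have b1 : (∃ z, p 1 z) → ∃ z, p 0 z := fun ⟨z, hz⟩ => a1 z hz
      have b2 : (∃ z, p 2 z) → ∃ z, p 1 z := fun ⟨z, hz⟩ => a2 z hz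
      have b3 : (∃ z, p 3 z) → ∃ z, p 2 z := fun ⟨z, hz⟩ => a3 z hz
      tauto
    rcases e with ⟨e0, e1, e2, e3⟩ | ⟨e0, e1, e2, e3⟩ <;>
      simp [windowCount, indicator, e0, e1, e2, e3] at h
  obtain ⟨h1, h2⟩ := hp.domino hm hs hs'
  have h3 := (windowCount_cases hm hs hs').1
  refine ⟨s, fun x => ?_⟩
  have hx := per (s + (x - s) % 4) ((x - s) / 4)
  rw [show s + (x - s) % 4 + 4 * ((x - s) / 4) = x by omega] at hx
  rw [hx]
  have : (x - s) % 4 = 0 ∨ (x - s) % 4 = 1 ∨ (x - s) % 4 = 2 ∨ (x - s) % 4 = 3 := by omega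
  rcases this with e | e | e | e <;> rw [e]
  · simpa using hs
  · exact iff_of_true ⟨_, hp.symm h1⟩ (by norm_num)
  · exact iff_of_false h2 (by norm_num)
  · exact iff_of_false h3 (by norm_num)

end IsLineMatching

/-! ### Markings of the plane -/

/-- Double counting on a `4 × 4` square: if `h` and `v` exclude each other, every horizontal window
has at least two `h`'s and every vertical one at least two `v`'s, then all these bounds are tight. -/
theorem tight_of_windowCount {h v : ℤ → ℤ → Prop} (hv : ∀ x y, h x y → ¬ v x y)
    (hh : ∀ x y, 2 ≤ windowCount (fun i => h i y) x)
    (hvv : ∀ x y, 2 ≤ windowCount (fun j => v x j) y) (x y : ℤ) :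
    (v x y ↔ ¬ h x y) ∧ windowCount (fun i => h i y) x = 2 ∧ windowCount (fun j => v x j) y = 2 := by
  have le : ∀ x y, indicator (h x y) + indicator (v x y) ≤ 1 := by
    intro x y
    have := hv x y
    by_cases h1 : h x y <;> by_cases h2 : v x y <;> simp_all [indicator]
  have r0 := hh x y
  have r1 := hh x (y + 1)
  have r2 := hh x (y + 2)
  have r3 := hh x (y + 3)
  have c0 := hvv x y
  have c1 := hvv (x + 1) y
  have c2 := hvv (x + 2) y
  have c3 := hvv (x + 3) y
  have l00 := le x y
  have l01 := le x (y + 1)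
  have l02 := le x (y + 2)
  have l03 := le x (y + 3)
  have l10 := le (x + 1) y
  have l11 := le (x + 1) (y + 1)
  have l12 := le (x + 1) (y + 2)
  have l13 := le (x + 1) (y + 3)
  have l20 := le (x + 2) y
  have l21 := le (x + 2) (y + 1)
  have l22 := le (x + 2) (y + 2)
  have l23 := le (x + 2) (y + 3)
  have l30 := le (x + 3) y
  have l31 := le (x + 3) (y + 1)
  have l32 := le (x + 3) (y + 2)
  have l33 := le (x + 3) (y + 3)
  simp only [windowCount] at *
  -- Four rows and four columns contribute at least 16 in total, the sixteen cells at most 16.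
  refine ⟨?_, le_antisymm (by linarith) r0, le_antisymm (by linarith) c0⟩
  have e : 1 ≤ indicator (h x y) + indicator (v x y) := by linarith
  have := hv x y
  by_cases h1 : h x y <;> by_cases h2 : v x y <;> simp_all [indicator]

set_option maxRecDepth 100000 in
set_option maxHeartbeats 4000000 in
set_option synthInstance.maxHeartbeats 400000 in
set_option synthInstance.maxSize 2000 in
/-- The arrangements on the `4 × 4` torus in which row `y` has its two cyclically consecutive marks
starting at `s y` and the unmarked cells of every column are cyclically consecutive. -/
theorem torus_classification_aux : ∀ s₀ s₁ s₂ s₃ : ZMod 4,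
    (∀ x, ∃ t : ZMod 4, ((x - s₀).val < 2 ↔ ¬ (0 - t).val < 2) ∧ ((x - s₁).val < 2 ↔ ¬ (1 - t).val < 2) ∧
      ((x - s₂).val < 2 ↔ ¬ (2 - t).val < 2) ∧ ((x - s₃).val < 2 ↔ ¬ (3 - t).val < 2)) →
    (s₁ = s₀ ∧ s₂ = s₀ + 2 ∧ s₃ = s₀ + 2) ∨ (s₁ = s₀ + 2 ∧ s₂ = s₀ + 2 ∧ s₃ = s₀) ∨
    (s₁ = s₀ + 1 ∧ s₂ = s₀ + 2 ∧ s₃ = s₀ + 3) ∨ (s₁ = s₀ - 1 ∧ s₂ = s₀ - 2 ∧ s₃ = s₀ - 3) := by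
  decide

theorem ZMod.val_intCast_four_lt_two (z : ℤ) : (z : ZMod 4).val < 2 ↔ z % 4 < 2 := by
  have h : ((z : ZMod 4).val : ℤ) = z % 4 := ZMod.val_intCast z
  omega

theorem ZMod.intCast_four_eq_iff (a b : ℤ) : (a : ZMod 4) = b ↔ a % 4 = b % 4 :=
  ZMod.intCast_eq_intCast_iff a b 4

/-- The columns have period 4, so the shifts of rows 0 to 3 modulo 4 determine everything and the
torus enumeration applies. -/
theorem marking_classification {h : ℤ → ℤ → Prop}
    (hrow : ∀ y, ∃ s : ℤ, ∀ x, h x y ↔ (x - s) % 4 < 2)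
    (hcol : ∀ x, ∃ t : ℤ, ∀ y, ¬ h x y ↔ (y - t) % 4 < 2) :
    (∃ a b : ℤ, ∀ x y, h x y ↔ ((x - a) % 4 < 2 ↔ (y - b) % 4 < 2)) ∨
    (∃ a : ℤ, ∀ x y, h x y ↔ (x - y - a) % 4 < 2) ∨
    (∃ a : ℤ, ∀ x y, h x y ↔ (x + y - a) % 4 < 2) := by
  choose s hs using hrow
  have per : ∀ x y, h x y ↔ h x (y % 4) := by
    intro x y
    obtain ⟨t, ht⟩ := hcol x
    rw [← not_iff_not, ht, ht]
    omega
  have aux := torus_classification_aux (s 0) (s 1) (s 2) (s 3) (by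
    intro x
    obtain ⟨z, rfl⟩ := ZMod.intCast_surjective x
    obtain ⟨t, ht⟩ := hcol z
    have key : ∀ y : ℤ, ((z : ZMod 4) - (s y : ZMod 4)).val < 2 ↔
        ¬ ((y : ZMod 4) - (t : ZMod 4)).val < 2 := by
      intro y
      rw [← Int.cast_sub, ← Int.cast_sub, ZMod.val_intCast_four_lt_two,
        ZMod.val_intCast_four_lt_two, ← hs, ← ht, not_not]
    exact ⟨t, by simpa using key 0, by simpa using key 1, by simpa using key 2,
      by simpa using key 3⟩)
  have hy : ∀ y : ℤ, y % 4 = 0 ∨ y % 4 = 1 ∨ y % 4 = 2 ∨ y % 4 = 3 := by omega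
  have aux' : (s 1 % 4 = s 0 % 4 ∧ s 2 % 4 = (s 0 + 2) % 4 ∧ s 3 % 4 = (s 0 + 2) % 4) ∨
      (s 1 % 4 = (s 0 + 2) % 4 ∧ s 2 % 4 = (s 0 + 2) % 4 ∧ s 3 % 4 = s 0 % 4) ∨
      (s 1 % 4 = (s 0 + 1) % 4 ∧ s 2 % 4 = (s 0 + 2) % 4 ∧ s 3 % 4 = (s 0 + 3) % 4) ∨
      (s 1 % 4 = (s 0 - 1) % 4 ∧ s 2 % 4 = (s 0 - 2) % 4 ∧ s 3 % 4 = (s 0 - 3) % 4) := by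
    simpa only [← ZMod.intCast_four_eq_iff, Int.cast_add, Int.cast_sub, Int.cast_ofNat,
      Int.cast_one] using aux
  rcases aux' with ⟨e1, e2, e3⟩ | ⟨e1, e2, e3⟩ | ⟨e1, e2, e3⟩ | ⟨e1, e2, e3⟩
  · refine Or.inl ⟨s 0, 0, fun x y => ?_⟩
    rw [per, hs]
    rcases hy y with e | e | e | e <;> rw [e] <;> omega
  -- Here rows 3 and 0 agree modulo 4, so a chessboard field starts at height -1.
  · refine Or.inl ⟨s 0, -1, fun x y => ?_⟩
    rw [per, hs]
    rcases hy y with e | e | e | e <;> rw [e] <;> omega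
  · refine Or.inr (Or.inl ⟨s 0, fun x y => ?_⟩)
    rw [per, hs]
    rcases hy y with e | e | e | e <;> rw [e] <;> omega
  · refine Or.inr (Or.inr ⟨s 0, fun x y => ?_⟩)
    rw [per, hs]
    rcases hy y with e | e | e | e <;> rw [e] <;> omega

/-! ### Pairings on an arbitrary vertex set -/

namespace IsWinningPairing

variable {V : Type*} {E : Set (Set V)} {X Y : Set V} {ρ : V → V}

theorem mem_pairsOf_iff {a b : V} :
    s(a, b) ∈ pairsOf X ρ ↔ (a ∈ X ∧ ρ a = b) ∨ (b ∈ X ∧ ρ b = a) := by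
  simp only [pairsOf, Set.mem_image, Sym2.eq_iff]
  constructor
  · rintro ⟨x, hx, ⟨rfl, rfl⟩ | ⟨rfl, rfl⟩⟩
    · exact Or.inl ⟨hx, rfl⟩
    · exact Or.inr ⟨hx, rfl⟩
  · rintro (⟨hx, rfl⟩ | ⟨hx, rfl⟩)
    · exact ⟨a, hx, Or.inl ⟨rfl, rfl⟩⟩
    · exact ⟨b, hx, Or.inr ⟨rfl, rfl⟩⟩

theorem pair_unique (h : IsWinningPairing E X Y ρ) {a b c : V} (hb : s(a, b) ∈ pairsOf X ρ)
    (hc : s(a, c) ∈ pairsOf X ρ) : b = c := by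
  have disj : ∀ {x}, x ∈ X → ∀ {y}, y ∈ X → ρ y = x → False := fun hx y hy e =>
    Set.disjoint_left.1 h.disjoint hx (e ▸ h.bijOn.mapsTo hy)
  rw [mem_pairsOf_iff] at hb hc
  rcases hb with ⟨hb, eb⟩ | ⟨hb, eb⟩ <;> rcases hc with ⟨hc, ec⟩ | ⟨hc, ec⟩
  · exact eb.symm.trans ec
  · exact (disj hb hc ec).elim
  · exact (disj hc hb eb).elim
  · exact h.bijOn.injOn hb hc (eb.trans ec.symm)

theorem pair_ne (h : IsWinningPairing E X Y ρ) {a : V} : s(a, a) ∉ pairsOf X ρ := by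
  intro ha
  rw [mem_pairsOf_iff, or_self] at ha
  exact Set.disjoint_left.1 h.disjoint ha.1 (ha.2 ▸ h.bijOn.mapsTo ha.1)

theorem exists_pair (h : IsWinningPairing E X Y ρ) {A : Set V} (hA : A ∈ E) :
    ∃ a b, a ∈ A ∧ b ∈ A ∧ s(a, b) ∈ pairsOf X ρ := by
  obtain ⟨x, hx, hxA⟩ := h.blocks A hA
  exact ⟨x, ρ x, hxA (by simp), hxA (by simp), x, hx, rfl⟩

/-- A family of pairs of a pairing that covers all vertices is the whole pairing. -/
theorem eq_of_subset_of_cover (h : IsWinningPairing E X Y ρ) {S : Set (Sym2 V)}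
    (hS : S ⊆ pairsOf X ρ) (hcover : ∀ a, ∃ b, s(a, b) ∈ S) : pairsOf X ρ = S := by
  refine Set.Subset.antisymm (fun q hq => ?_) hS
  induction q with
  | _ a b =>
    obtain ⟨c, hc⟩ := hcover a
    rwa [h.pair_unique hq (hS hc)]

end IsWinningPairing

/-! ### From a pairing to a marking of the grid -/

section Grid

variable {X Y : Set Cell} {ρ : Cell → Cell}

theorem IsWinningPairing.row_isLineMatching
    (h : IsWinningPairing (straightPolyominoes 5) X Y ρ) (y : ℤ) :
    IsLineMatching fun a b => s((a, y), (b, y)) ∈ pairsOf X ρ where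
  symm hab := by rwa [Sym2.eq_swap]
  unique hb hc := congrArg Prod.fst (h.pair_unique hb hc)
  window a := by
    obtain ⟨c, d, ⟨i, hi, rfl⟩, ⟨j, hj, rfl⟩, hp⟩ := h.exists_pair ⟨a, y, Or.inl rfl⟩
    rcases lt_trichotomy i j with hij | rfl | hij
    · exact ⟨a + i, a + j, by omega, by omega, by omega, hp⟩
    · exact (h.pair_ne hp).elim
    · exact ⟨a + j, a + i, by omega, by omega, by omega, by rwa [Sym2.eq_swap]⟩

theorem IsWinningPairing.column_isLineMatching
    (h : IsWinningPairing (straightPolyominoes 5) X Y ρ) (x : ℤ) :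
    IsLineMatching fun a b => s((x, a), (x, b)) ∈ pairsOf X ρ where
  symm hab := by rwa [Sym2.eq_swap]
  unique hb hc := congrArg Prod.snd (h.pair_unique hb hc)
  window a := by
    obtain ⟨c, d, ⟨i, hi, rfl⟩, ⟨j, hj, rfl⟩, hp⟩ := h.exists_pair ⟨x, a, Or.inr rfl⟩
    rcases lt_trichotomy i j with hij | rfl | hij
    · exact ⟨a + i, a + j, by omega, by omega, by omega, hp⟩
    · exact (h.pair_ne hp).elim
    · exact ⟨a + j, a + i, by omega, by omega, by omega, by rwa [Sym2.eq_swap]⟩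

/-- The cells matched within their row determine the pairing: lying dominoes start where a run of
such cells starts, standing dominoes start where a vertical run of other cells starts. -/
theorem IsWinningPairing.exists_marking (h : IsWinningPairing (straightPolyominoes 5) X Y ρ) :
    ∃ m : ℤ → ℤ → Prop,
      (∀ y, ∃ s : ℤ, ∀ x, m x y ↔ (x - s) % 4 < 2) ∧
      (∀ x, ∃ t : ℤ, ∀ y, ¬ m x y ↔ (y - t) % 4 < 2) ∧
      (∀ x y, m x y → ¬ m (x - 1) y → lying x y ∈ pairsOf X ρ) ∧
      (∀ x y, ¬ m x y → m x (y - 1) → standing x y ∈ pairsOf X ρ) := by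
  have tight := tight_of_windowCount
    (h := fun x y => ∃ z, s((x, y), (z, y)) ∈ pairsOf X ρ)
    (v := fun x y => ∃ z, s((x, y), (x, z)) ∈ pairsOf X ρ)
    (by
      rintro x y ⟨z, hz⟩ ⟨w, hw⟩
      -- A common partner in both row and column would be the cell itself.
      have e := h.pair_unique hz hw
      obtain ⟨rfl, -⟩ := Prod.mk.inj e
      exact h.pair_ne hz)
    (fun x y => (h.row_isLineMatching y).two_le_windowCount x)
    (fun x y => (h.column_isLineMatching x).two_le_windowCount y)
  have hr := fun y a => (tight a y).2.1
  have hc := fun x a => (tight x a).2.2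
  have hv := fun x y => (tight x y).1
  refine ⟨fun x y => ∃ z, s((x, y), (z, y)) ∈ pairsOf X ρ, fun y => ?_, fun x => ?_, ?_, ?_⟩
  · exact (h.row_isLineMatching y).exists_shift (hr y)
  · obtain ⟨t, ht⟩ := (h.column_isLineMatching x).exists_shift (hc x)
    exact ⟨t, fun y => (hv x y).symm.trans (ht y)⟩
  · exact fun x y h1 h2 => ((h.row_isLineMatching y).domino (hr y) h1 h2).1
  · exact fun x y h1 h2 => ((h.column_isLineMatching x).domino (hc x) ((hv x y).2 h1)
      fun h3 => (hv x (y - 1)).1 h3 h2).1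

end Grid

/-! ### Recognizing the two patterns -/

theorem patternT1_cover (c : Cell) : ∃ d, s(c, d) ∈ patternT1 := by
  obtain ⟨x, y⟩ := c
  have hx : x = 2 * (x / 2) ∨ x = 2 * (x / 2) + 1 := by omega
  have hy : y = 2 * (y / 2) ∨ y = 2 * (y / 2) + 1 := by omega
  generalize x / 2 = i at hx
  generalize y / 2 = j at hy
  rcases Int.even_or_odd (i + j) with e | e
  · rcases hx with rfl | rfl
    · refine ⟨(2 * i + 1, y), Or.inl ⟨i, j, e, ?_⟩⟩
      rcases hy with rfl | rfl
      exacts [Or.inl rfl, Or.inr rfl]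
    · refine ⟨(2 * i, y), Or.inl ⟨i, j, e, ?_⟩⟩
      rcases hy with rfl | rfl
      exacts [Or.inl Sym2.eq_swap, Or.inr Sym2.eq_swap]
  · rcases hy with rfl | rfl
    · refine ⟨(x, 2 * j + 1), Or.inr ⟨i, j, e, ?_⟩⟩
      rcases hx with rfl | rfl
      exacts [Or.inl rfl, Or.inr rfl]
    · refine ⟨(x, 2 * j), Or.inr ⟨i, j, e, ?_⟩⟩
      rcases hx with rfl | rfl
      exacts [Or.inl Sym2.eq_swap, Or.inr Sym2.eq_swap]

theorem patternT2_cover (c : Cell) : ∃ d, s(c, d) ∈ patternT2 := by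
  obtain ⟨x, y⟩ := c
  have : (x - y) % 4 = 0 ∨ (x - y) % 4 = 1 ∨ (x - y) % 4 = 2 ∨ (x - y) % 4 = 3 := by omega
  simp only [patternT2, Int.ModEq]
  rcases this with e | e | e | e
  · exact ⟨(x + 1, y), Or.inl ⟨x, y, by omega, rfl⟩⟩
  · exact ⟨(x - 1, y), Or.inl ⟨x - 1, y, by omega, by rw [lying, sub_add_cancel, Sym2.eq_swap]⟩⟩
  · exact ⟨(x, y - 1), Or.inr ⟨x, y - 1, by omega, by
      rw [standing, sub_add_cancel, Sym2.eq_swap]⟩⟩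
  · exact ⟨(x, y + 1), Or.inr ⟨x, y, by omega, rfl⟩⟩

theorem quarterTurn_surjective : Function.Surjective quarterTurn := fun c =>
  ⟨(c.2, -c.1), by simp [quarterTurn]⟩

/-- One inclusion suffices, because the moved copy of `T` still covers every cell. -/
theorem IsWinningPairing.isCopy {E : Set (Set Cell)} {X Y : Set Cell} {ρ : Cell → Cell}
    (h : IsWinningPairing E X Y ρ) {T : Set (Sym2 Cell)} (hT : ∀ c, ∃ d, s(c, d) ∈ T) (k : ℕ)
    (t : Cell) (hsub : ∀ q ∈ T, Sym2.map (fun c => quarterTurn^[k] c + t) q ∈ pairsOf X ρ) :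
    IsCopy (pairsOf X ρ) T := by
  refine ⟨k, t, h.eq_of_subset_of_cover ?_ fun a => ?_⟩
  · rintro _ ⟨q, hq, rfl⟩
    exact hsub q hq
  · obtain ⟨c, hc⟩ := quarterTurn_surjective.iterate k (a - t)
    obtain ⟨d, hd⟩ := hT c
    refine ⟨quarterTurn^[k] d + t, s(c, d), hd, ?_⟩
    simp [hc]

theorem map_translate_lying (x y a b : ℤ) :
    Sym2.map (fun c => quarterTurn^[0] c + (a, b)) (lying x y) = lying (x + a) (y + b) := by
  simp [lying, add_right_comm]

theorem map_translate_standing (x y a b : ℤ) :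
    Sym2.map (fun c => quarterTurn^[0] c + (a, b)) (standing x y) = standing (x + a) (y + b) := by
  simp [standing, add_right_comm]

theorem map_turn_lying (x y a b : ℤ) :
    Sym2.map (fun c => quarterTurn^[1] c + (a, b)) (lying x y) = standing (-y + a) (x + b) := by
  simp [lying, standing, quarterTurn, add_right_comm]

theorem map_turn_standing (x y a b : ℤ) :
    Sym2.map (fun c => quarterTurn^[1] c + (a, b)) (standing x y) =
      lying (-y - 1 + a) (x + b) := by
  have e₁ : -y - 1 + a + 1 = -y + a := by ring
  have e₂ : -(y + 1) + a = -y - 1 + a := by ring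
  rw [lying, Sym2.eq_swap]
  simp only [standing, quarterTurn, Sym2.map_mk, Function.iterate_one, Prod.mk_add_mk, e₁, e₂]

theorem lemma9 (X Y : Set Cell) (ρ : Cell → Cell)
    (h : IsWinningPairing (straightPolyominoes 5) X Y ρ) :
    IsCopy (pairsOf X ρ) patternT1 ∨ IsCopy (pairsOf X ρ) patternT2 := by
  obtain ⟨m, hrow, hcol, hl, hs⟩ := h.exists_marking
  rcases marking_classification hrow hcol with ⟨a, b, hm⟩ | ⟨a, hm⟩ | ⟨a, hm⟩ <;>
    simp only [hm] at hl hs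
  · refine Or.inl (h.isCopy patternT1_cover 0 (a, b) ?_)
    rintro q (⟨i, j, e, rfl | rfl⟩ | ⟨i, j, e, rfl | rfl⟩)
    · rw [map_translate_lying]
      rw [Int.even_iff] at e
      apply hl <;> omega
    · rw [map_translate_lying]
      rw [Int.even_iff] at e
      apply hl <;> omega
    · rw [map_translate_standing]
      rw [Int.odd_iff] at e
      apply hs <;> omega
    · rw [map_translate_standing]
      rw [Int.odd_iff] at e
      apply hs <;> omega
  · refine Or.inr (h.isCopy patternT2_cover 0 (a, 0) ?_)
    rintro q (⟨x, y, e, rfl⟩ | ⟨x, y, e, rfl⟩)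
    · rw [map_translate_lying]
      rw [Int.ModEq] at e
      apply hl <;> omega
    · rw [map_translate_standing]
      rw [Int.ModEq] at e
      apply hs <;> omega
  -- The quarter turn makes the stripes antidiagonal and exchanges lying and standing dominoes.
  -- Standing ones must start where `x + y ≡ a + 2`, which modulo 4 is the shift `a - 2`.
  · refine Or.inr (h.isCopy patternT2_cover 1 (a - 2, 0) ?_)
    rintro q (⟨x, y, e, rfl⟩ | ⟨x, y, e, rfl⟩)
    · rw [map_turn_lying]
      rw [Int.ModEq] at e
      apply hs <;> omega
    · rw [map_turn_standing]
      rw [Int.ModEq] at e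
      apply hl <;> omega
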